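/- Theorem 4.7. All rings are commutative with identity. A ring $R$ is called self-injective if every $R$-module homomorphism $I\to R$ from an ideal $I$ of $R$ extends to an $R$-module homomorphism $R\to R$. For a topological space $X$, let $C(X,\mathbb{R}_{disc})$ be the ring, under pointwise operations, of all locally constant functions $f\colon X\to\mathbb{R}$ (equivalently, functions that are continuous when $\mathbb{R}$ carries the discrete topology), let $C_F(X)$ be its ideal of functions $f$ for which $\{x\in X: f(x)\neq 0\}$ is finite, and let $\mathbb{I}(X)$ be the set of isolated points of $X$. A space $Y$ is called extremally disconnected if the closure of every open subset of $Y$ is open, and a $P_{\mathfrak{c}^+}$-space if the intersection of every family of at most $\mathfrak{c}=2^{\aleph_0}$ clopen subsets of $Y$ is clopen. A subset $Y\subseteq X$ is called $C_d$-embedded in $X$ if every $f\in C(Y,\mathbb{R}_{disc})$ is the restriction to $Y$ of some $F\in C(X,\mathbb{R}_{disc})$. Subsets of $X$ carry the subspace topology. Let $X$ be a zero-dimensional Hausdorff space, that is, a Hausdorff space with a base of clopen sets. Then the factor ring $C(X,\mathbb{R}_{disc})/C_F(X)$ is self-injective if and only if the following three conditions hold: 1. every infinite set of isolated points of $X$ has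 a limit point in $X$ (a point $x\in X$ each of whose neighbourhoods contains a point of the set different from $x$); 2. $X\setminus\mathbb{I}(X)$ is an extremally disconnected $P_{\mathfrak{c}^+}$-space; 3. $X\setminus\mathbb{I}(X)$ is $C_d$-embedded in $X$. -/

import Mathlib

/-- A commutative ring `R` is self-injective if every `R`-linear map `I → R` defined on an ideal `I`
of `R` extends to an `R`-linear map `R → R` (this is what `Module.Baer R R` says). -/
def IsSelfInjective (R : Type*) [CommRing R] : Prop :=
  Module.Baer R R

/-- A topological space is zero-dimensional if its clopen subsets form a base of its topology. -/
def IsZeroDimensional (X : Type*) [TopologicalSpace X] : Prop :=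
  TopologicalSpace.IsTopologicalBasis {s : Set X | IsClopen s}

/-- The set of isolated points of `X`. -/
def isolatedPoints (X : Type*) [TopologicalSpace X] : Set X :=
  {x | IsOpen ({x} : Set X)}

/-- `X` is a `P_{𝔠⁺}`-space: the intersection of any collection of at most `2 ^ ℵ₀` clopen subsets
is clopen. -/
def IsPContinuumSuccSpace (X : Type*) [TopologicalSpace X] : Prop :=
  ∀ S : Set (Set X), (∀ s ∈ S, IsClopen s) → Cardinal.mk S ≤ Cardinal.continuum →
    IsClopen (⋂₀ S)

/-- `Y ⊆ X` is `C_d`-embedded in `X`: every continuous function from the subspace `Y` to the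
discrete space of real numbers, i.e. every locally constant real function on `Y`, is the restriction
of such a function on `X`. -/
def IsCdEmbedded {X : Type*} [TopologicalSpace X] (Y : Set X) : Prop :=
  ∀ f : LocallyConstant Y ℝ, ∃ F : LocallyConstant X ℝ, ∀ y : Y, F (y : X) = f y

/-- The ideal `C_F(X)` of the ring `C(X, ℝ_disc)` of locally constant real functions, consisting of
the functions with finite support. (On a Hausdorff space every continuous real function with finite
support is locally constant, so no function is lost.) -/
def finiteSupportIdeal (X : Type*) [TopologicalSpace X] : Ideal (LocallyConstant X ℝ) where
  carrier := {f | (Function.support f).Finite}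
  zero_mem' := by simp
  add_mem' := by
    intro f g hf hg
    exact (hf.union hg).subset (Function.support_add f g)
  smul_mem' := by
    intro c f hf
    exact Set.Finite.subset hf fun x hx h => hx (by
      have h0 : f x = 0 := h
      simp [h0])

/-! Let `Y` be the set of non-isolated points. Functions in `C_F(X)` vanish on `Y`, and under
condition 1 the converse holds. With condition 3 the quotient is then the ring of locally constant
functions on `Y`.

If the quotient is self-injective, any relation well defined modulo `C_F(X)` is multiplication by
some `g`. Diagonalizing over an almost disjoint family gives condition 1; relations prescribed on
dense subsets of `Y` give the rest.

Conversely, a homomorphism `h ↦ k` determines ratios `k / h` on an open subset of `Y`. Their level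
sets are at most continuum many disjoint open sets, which condition 2 lets one glue into a
multiplier. -/

section SelfInjective

/-- Over a self-injective quotient `A ⧸ C`, a submodule of `A × A` that is the graph of a function
modulo `C` is given by multiplication by an element of `A`. -/
theorem IsSelfInjective.exists_mul_sub_mem {A : Type*} [CommRing A] {C : Ideal A}
    (hA : IsSelfInjective (A ⧸ C)) (P : Submodule A (A × A))
    (hP : ∀ p ∈ P, p.1 ∈ C → p.2 ∈ C) : ∃ g : A, ∀ p ∈ P, p.2 - g * p.1 ∈ C := by
  classical
  let I : Ideal (A ⧸ C) := Ideal.map (Ideal.Quotient.mk C) (P.map (LinearMap.fst A A A))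
  have hI : ∀ z : I, ∃ p ∈ P, Ideal.Quotient.mk C p.1 = z := by
    rintro ⟨z, hz⟩
    obtain ⟨a, ha, rfl⟩ :=
      (Ideal.mem_map_iff_of_surjective _ Ideal.Quotient.mk_surjective).1 hz
    obtain ⟨p, hp, rfl⟩ := ha
    exact ⟨p, hp, rfl⟩
  choose q hqP hq using hI
  have key : ∀ (z : I) (p), p ∈ P → Ideal.Quotient.mk C p.1 = z →
      Ideal.Quotient.mk C (q z).2 = Ideal.Quotient.mk C p.2 := by
    intro z p hp hz
    rw [Ideal.Quotient.eq]
    refine hP (q z - p) (P.sub_mem (hqP z) hp) ?_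
    rw [Prod.fst_sub, ← Ideal.Quotient.eq, hq, hz]
  let φ : I →ₗ[A ⧸ C] A ⧸ C :=
    { toFun := fun z => Ideal.Quotient.mk C (q z).2
      map_add' := by
        intro x y
        rw [key (x + y) (q x + q y) (P.add_mem (hqP x) (hqP y)) (by simp [hq])]
        simp
      map_smul' := by
        intro c x
        obtain ⟨a, rfl⟩ := Ideal.Quotient.mk_surjective c
        rw [key (Ideal.Quotient.mk C a • x) (a • q x) (P.smul_mem a (hqP x)) (by simp [hq])]
        simp }
  obtain ⟨ψ, hψ⟩ := hA I φ
  obtain ⟨g, hg⟩ := Ideal.Quotient.mk_surjective (ψ 1)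
  refine ⟨g, fun p hp => ?_⟩
  have hmem : Ideal.Quotient.mk C p.1 ∈ I :=
    Ideal.mem_map_of_mem _ (Submodule.mem_map_of_mem (f := LinearMap.fst A A A) hp)
  have h1 := hψ _ hmem
  have h2 : φ ⟨_, hmem⟩ = Ideal.Quotient.mk C p.2 := key ⟨_, hmem⟩ p hp rfl
  have h3 : ψ (Ideal.Quotient.mk C p.1) = Ideal.Quotient.mk C p.1 * ψ 1 := by
    rw [← smul_eq_mul, ← map_smul, smul_eq_mul, mul_one]
  rw [← Ideal.Quotient.eq, ← h2, ← h1, h3, ← hg, map_mul, mul_comm]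

end SelfInjective

/-! ### Isolated points and finitely supported functions. -/

section Isolated

variable {X : Type*} [TopologicalSpace X]

theorem mem_finiteSupportIdeal {f : LocallyConstant X ℝ} :
    f ∈ finiteSupportIdeal X ↔ (Function.support f).Finite :=
  Iff.rfl

theorem LocallyConstant.isClopen_support (f : LocallyConstant X ℝ) :
    IsClopen (Function.support f) :=
  f.isLocallyConstant.isClopen_fiber 0 |>.compl

/-- Every point of a finite open set in a T1 space is isolated. -/
theorem apply_eq_zero_of_mem_finiteSupportIdeal [T1Space X] {f : LocallyConstant X ℝ}
    (hf : f ∈ finiteSupportIdeal X) {y : X} (hy : y ∈ (isolatedPoints X)ᶜ) : f y = 0 := by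
  by_contra h
  refine hy ?_
  have h1 : IsOpen (Function.support f \ (Function.support f \ {y})) :=
    f.isClopen_support.isOpen.sdiff
      ((mem_finiteSupportIdeal.1 hf).subset Set.sdiff_subset).isClosed
  have h2 : Function.support f \ (Function.support f \ {y}) = {y} := by
    rw [Set.sdiff_sdiff_cancel_left]
    simpa using h
  rwa [h2] at h1

theorem not_accPt_of_mem_isolatedPoints {x : X} (hx : x ∈ isolatedPoints X) (S : Set X) :
    ¬ AccPt x (Filter.principal S) := by
  intro h
  rw [accPt_iff_nhds] at h
  obtain ⟨y, hy, hne⟩ := h {x} (IsOpen.mem_nhds hx rfl)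
  exact hne hy.1

/-- If infinite sets of isolated points accumulate, locally constant functions vanishing at the
non-isolated points have finite support. -/
theorem mem_finiteSupportIdeal_of_eqOn
    (h1 : ∀ S : Set X, S ⊆ isolatedPoints X → S.Infinite → ∃ x, AccPt x (Filter.principal S))
    {f : LocallyConstant X ℝ} (hf : ∀ y ∈ (isolatedPoints X)ᶜ, f y = 0) :
    f ∈ finiteSupportIdeal X := by
  rw [mem_finiteSupportIdeal]
  by_contra hinf
  have hsub : Function.support f ⊆ isolatedPoints X := by
    intro x hx
    by_contra h
    exact hx (hf x h)
  obtain ⟨x, hx⟩ := h1 _ hsub hinf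
  have hxs : x ∈ Function.support f :=
    (isClosed_iff_derivedSet_subset _).1 f.isClopen_support.isClosed hx
  exact not_accPt_of_mem_isolatedPoints (hsub hxs) _ hx

theorem isOpen_of_subset_isolatedPoints {T : Set X} (hT : T ⊆ isolatedPoints X) : IsOpen T := by
  rw [← Set.biUnion_of_singleton T]
  exact isOpen_biUnion fun x hx => hT hx

theorem isLocallyConstant_of_support_subset {S : Set X} (hS : S ⊆ isolatedPoints X)
    (hc : IsClosed S) {g : X → ℝ} (hg : ∀ x ∉ S, g x = 0) : IsLocallyConstant g := by
  rw [IsLocallyConstant.iff_eventually_eq]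
  intro x
  by_cases hx : x ∈ S
  · filter_upwards [IsOpen.mem_nhds (hS hx : IsOpen {x}) rfl] with y hy
    rw [hy]
  · filter_upwards [hc.isOpen_compl.mem_nhds hx] with y hy
    rw [hg y hy, hg x hx]

end Isolated

/-! ### Branches of the binary tree as an almost disjoint family. -/

section AlmostDisjoint

/-- The set of finite initial segments of a binary sequence. -/
def initialSegments (b : ℕ → Bool) : Set (List Bool) :=
  Set.range fun n => (List.range n).map b

theorem initialSegments_infinite (b : ℕ → Bool) : (initialSegments b).Infinite := by
  refine Set.infinite_range_of_injective fun m n h => ?_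
  simpa using congrArg List.length h

theorem initialSegments_inter_finite {b c : ℕ → Bool} (h : b ≠ c) :
    (initialSegments b ∩ initialSegments c).Finite := by
  obtain ⟨m, hm⟩ := Function.ne_iff.1 h
  refine ((Set.finite_Iic m).image fun n => (List.range n).map b).subset ?_
  rintro _ ⟨⟨n, rfl⟩, ⟨k, hk⟩⟩
  refine ⟨n, ?_, rfl⟩
  have hkn : k = n := by simpa using congrArg List.length hk
  subst hkn
  by_contra hlt
  have hlt : m < k := not_le.1 hlt
  simp only [List.map_inj_left, List.mem_range] at hk
  exact hm (hk m hlt).symm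

/-- Since `𝔠 ^ ℵ₀ = 2 ^ ℵ₀`, every real function on the tree can be assigned its own branch, as the
diagonal argument requires. -/
theorem nonempty_function_embedding : Nonempty ((List Bool → ℝ) ↪ (ℕ → Bool)) := by
  rw [← Cardinal.le_def]
  simp [Cardinal.mk_real]

end AlmostDisjoint

/-! ### Necessity of the three conditions. -/

section Forward

variable {X : Type*} [TopologicalSpace X]

theorem exists_accPt_of_isSelfInjective
    (hR : IsSelfInjective (LocallyConstant X ℝ ⧸ finiteSupportIdeal X))
    {S : Set X} (hS : S ⊆ isolatedPoints X) (hinf : S.Infinite) :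
    ∃ x : X, AccPt x (Filter.principal S) := by
  classical
  by_contra! hacc
  have hclosed : ∀ T ⊆ S, IsClosed T := by
    intro T hT
    rw [isClosed_iff_derivedSet_subset]
    intro x hx
    exact (hacc x (AccPt.mono hx (Filter.principal_mono.2 hT))).elim
  have : Infinite S := hinf.to_subtype
  obtain ⟨e₀⟩ : Nonempty (List Bool ↪ S) :=
    ⟨(⟨Encodable.encode, Encodable.encode_injective⟩ : List Bool ↪ ℕ).trans (Infinite.natEmbedding S)⟩
  let e : List Bool ↪ X := e₀.trans (Function.Embedding.subtype _)
  have heS : ∀ l, e l ∈ S := fun l => (e₀ l).2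
  obtain ⟨σ⟩ := nonempty_function_embedding
  let N : (List Bool → ℝ) → Set (List Bool) := fun f => initialSegments (σ f)
  -- On the branch of `f` the relation multiplies by `f + 1`, up to finitely many nodes. Confining
  -- `p.2` to finitely many branches makes these exceptions finite in total, so the relation is well
  -- defined modulo finite support.
  let P : Submodule (LocallyConstant X ℝ) (LocallyConstant X ℝ × LocallyConstant X ℝ) :=
    { carrier := {p | (∃ Φ : Set (List Bool → ℝ), Φ.Finite ∧
          (Function.support p.2 \ ⋃ f ∈ Φ, e '' N f).Finite) ∧
          ∀ f, {l ∈ N f | p.2 (e l) ≠ p.1 (e l) * (f l + 1)}.Finite}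
      zero_mem' := ⟨⟨∅, Set.finite_empty, by simp⟩, by simp⟩
      add_mem' := by
        rintro p q ⟨⟨Φ, hΦ, hp⟩, hp'⟩ ⟨⟨Ψ, hΨ, hq⟩, hq'⟩
        refine ⟨⟨Φ ∪ Ψ, hΦ.union hΨ, (hp.union hq).subset ?_⟩, fun f =>
          ((hp' f).union (hq' f)).subset ?_⟩
        · rintro x ⟨hx, hxn⟩
          rw [Set.biUnion_union] at hxn
          by_cases h : p.2 x = 0
          · right
            refine ⟨fun h' => hx ?_, fun h' => hxn (Or.inr h')⟩
            simp [h, h']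
          · exact Or.inl ⟨h, fun h' => hxn (Or.inl h')⟩
        · rintro l ⟨hl, hne⟩
          by_cases h : p.2 (e l) = p.1 (e l) * (f l + 1)
          · right
            refine ⟨hl, fun h' => hne ?_⟩
            simp only [Prod.snd_add, Prod.fst_add, LocallyConstant.coe_add, Pi.add_apply, h, h']
            ring
          · exact Or.inl ⟨hl, h⟩
      smul_mem' := by
        rintro c p ⟨⟨Φ, hΦ, hp⟩, hp'⟩
        refine ⟨⟨Φ, hΦ, hp.subset ?_⟩, fun f => (hp' f).subset ?_⟩
        · rintro x ⟨hx, hxn⟩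
          refine ⟨fun h => hx ?_, hxn⟩
          simp [h]
        · rintro l ⟨hl, hne⟩
          refine ⟨hl, fun h => hne ?_⟩
          simp [h, mul_assoc] }
  obtain ⟨g, hg⟩ := hR.exists_mul_sub_mem P (by
    rintro p ⟨⟨Φ, hΦ, hp⟩, hp'⟩ hC
    rw [mem_finiteSupportIdeal] at hC ⊢
    refine (hp.union ((hΦ.biUnion fun f _ => (hp' f).image e).union hC)).subset ?_
    intro x hx
    by_cases hxU : x ∈ ⋃ f ∈ Φ, e '' N f
    · right
      by_cases hx0 : p.1 x = 0
      · left
        simp only [Set.mem_iUnion] at hxU ⊢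
        obtain ⟨f, hf, l, hl, rfl⟩ := hxU
        refine ⟨f, hf, l, ⟨hl, ?_⟩, rfl⟩
        rw [hx0, zero_mul]
        exact hx
      · exact Or.inr hx0
    · exact Or.inl ⟨hx, hxU⟩)
  -- Diagonal choice: on the branch of `f`, the relation demands `g + 1` where the multiplier gives
  -- `g`.
  let f : List Bool → ℝ := fun l => g (e l)
  have hsub : e '' N f ⊆ S := by
    rintro _ ⟨l, -, rfl⟩
    exact heS l
  have hcl := hclosed _ hsub
  let h : LocallyConstant X ℝ := ⟨fun x => if x ∈ e '' N f then 1 else 0,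
    isLocallyConstant_of_support_subset (hsub.trans hS) hcl fun x hx => if_neg hx⟩
  have hh : ∀ x, h x = if x ∈ e '' N f then 1 else 0 := fun x => rfl
  have hmem : (h, (g + 1) * h) ∈ P := by
    refine ⟨⟨{f}, Set.finite_singleton f, ?_⟩, fun f' => ?_⟩
    · convert Set.finite_empty
      rw [Set.sdiff_eq_empty]
      intro x hx
      simp only [Set.mem_singleton_iff, Set.iUnion_iUnion_eq_left]
      by_contra hxn
      refine hx ?_
      rw [LocallyConstant.mul_apply, hh x, if_neg hxn, mul_zero]
    · by_cases hff : f' = f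
      · subst hff
        convert Set.finite_empty
        ext l
        simp [f, mul_comm]
      · refine (initialSegments_inter_finite (fun H => hff (σ.injective H))).subset
          (?_ : _ ⊆ N f' ∩ N f)
        rintro l ⟨hl, hne⟩
        refine ⟨hl, ?_⟩
        by_contra hl'
        refine hne ?_
        have : h (e l) = 0 := by
          rw [hh, if_neg]
          rwa [Function.Injective.mem_set_image e.injective]
        simp [this]
  have hfin := hg _ hmem
  have heq : (g + 1) * h - g * h = h := by ring
  simp only [heq, mem_finiteSupportIdeal] at hfin
  refine ((initialSegments_infinite (σ f)).image e.injective.injOn) (hfin.subset ?_)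
  intro x hx
  rw [Function.mem_support, hh, if_pos hx]
  exact one_ne_zero

/-- Over a self-injective quotient, a real function on the non-isolated points that is locally
constant at the points of a dense set agrees on that set with a locally constant function on `X`. -/
theorem exists_locallyConstant_extension [T1Space X] (hX : IsZeroDimensional X)
    (hR : IsSelfInjective (LocallyConstant X ℝ ⧸ finiteSupportIdeal X))
    {D : Set ↥(isolatedPoints X)ᶜ} (hD : Dense D) (f : ↥(isolatedPoints X)ᶜ → ℝ)
    (hf : ∀ y ∈ D, ∀ᶠ z in nhds y, f z = f y) :
    ∃ F : LocallyConstant X ℝ, ∀ y ∈ D, F (y : X) = f y := by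
  classical
  let P : Submodule (LocallyConstant X ℝ) (LocallyConstant X ℝ × LocallyConstant X ℝ) :=
    { carrier := {p | ∀ y ∈ D, p.2 (y : X) = p.1 (y : X) * f y}
      zero_mem' := by simp
      add_mem' := by
        intro p q hp hq y hy
        simp [hp y hy, hq y hy, add_mul]
      smul_mem' := by
        intro c p hp y hy
        simp [hp y hy, mul_assoc] }
  obtain ⟨g, hg⟩ := hR.exists_mul_sub_mem P (by
    intro p hp hC
    refine mem_finiteSupportIdeal_of_eqOn
      (fun S hS hi => exists_accPt_of_isSelfInjective hR hS hi) fun y hy => ?_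
    have hcl : IsClosed {z : ↥(isolatedPoints X)ᶜ | p.2 (z : X) = 0} :=
      (p.2.isLocallyConstant.isClopen_fiber 0).isClosed.preimage continuous_subtype_val
    have hsub : D ⊆ {z : ↥(isolatedPoints X)ᶜ | p.2 (z : X) = 0} := by
      intro z hz
      rw [Set.mem_ofPred_eq, hp z hz, apply_eq_zero_of_mem_finiteSupportIdeal hC z.2, zero_mul]
    have := hcl.closure_subset_iff.2 hsub (hD ⟨y, hy⟩)
    exact this)
  refine ⟨g, fun y hy => ?_⟩
  have hnh := hf y hy
  rw [nhds_subtype_eq_comap, Filter.eventually_comap] at hnh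
  obtain ⟨B, hB, hyB, hBsub⟩ := hX.mem_nhds_iff.1 hnh
  -- On the clopen set `B` around `y`, `f` is constant, so this pair tests the multiplier `g` at
  -- `y`.
  have hmem : (LocallyConstant.charFn ℝ hB, LocallyConstant.const X (f y) *
      LocallyConstant.charFn ℝ hB) ∈ P := by
    intro z hz
    by_cases hzB : (z : X) ∈ B
    · simp [hBsub hzB z rfl, mul_comm]
    · simp [LocallyConstant.coe_charFn, hzB]
  have h0 := apply_eq_zero_of_mem_finiteSupportIdeal (hg _ hmem) y.2
  have h1 : LocallyConstant.charFn ℝ hB (y : X) = 1 := by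
    simp [LocallyConstant.coe_charFn, hyB]
  simp only [LocallyConstant.coe_sub, LocallyConstant.coe_mul, Pi.sub_apply, Pi.mul_apply, h1,
    LocallyConstant.coe_const, Function.const_apply] at h0
  linarith

theorem isCdEmbedded_of_isSelfInjective [T1Space X] (hX : IsZeroDimensional X)
    (hR : IsSelfInjective (LocallyConstant X ℝ ⧸ finiteSupportIdeal X)) :
    IsCdEmbedded (isolatedPoints X)ᶜ := by
  intro f
  obtain ⟨F, hF⟩ := exists_locallyConstant_extension hX hR dense_univ f
    fun y _ => f.isLocallyConstant.eventually_eq y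
  exact ⟨F, fun y => hF y trivial⟩

/-- The indicator of `closure V` is locally constant on the dense set `V ∪ (closure V)ᶜ`; its
extension cuts out `closure V` as a clopen set. -/
theorem extremallyDisconnected_of_isSelfInjective [T1Space X] (hX : IsZeroDimensional X)
    (hR : IsSelfInjective (LocallyConstant X ℝ ⧸ finiteSupportIdeal X)) :
    ExtremallyDisconnected ↥(isolatedPoints X)ᶜ := by
  classical
  refine ⟨fun V hV => ?_⟩
  have hD : Dense (V ∪ (closure V)ᶜ) := by
    rw [dense_iff_closure_eq, closure_union, Set.eq_univ_iff_forall]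
    intro x
    by_cases hx : x ∈ closure V
    · exact Or.inl hx
    · exact Or.inr (subset_closure hx)
  obtain ⟨F, hF⟩ := exists_locallyConstant_extension hX hR hD
    (fun y => if y ∈ closure V then (1 : ℝ) else 0) (by
      rintro y (hy | hy)
      · filter_upwards [hV.mem_nhds hy] with z hz
        rw [if_pos (subset_closure hz), if_pos (subset_closure hy)]
      · filter_upwards [isClosed_closure.isOpen_compl.mem_nhds hy] with z hz
        rw [if_neg hz, if_neg hy])
  have hcl : IsClopen {z : ↥(isolatedPoints X)ᶜ | F (z : X) = 1} :=
    (F.isLocallyConstant.isClopen_fiber 1).preimage continuous_subtype_val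
  have heq : closure V = {z : ↥(isolatedPoints X)ᶜ | F (z : X) = 1} := by
    apply subset_antisymm
    · refine hcl.isClosed.closure_subset_iff.2 fun z hz => ?_
      rw [Set.mem_ofPred_eq, hF z (Or.inl hz), if_pos (subset_closure hz)]
    · intro z hz
      by_contra hn
      rw [Set.mem_ofPred_eq, hF z (Or.inr hn), if_neg hn] at hz
      exact zero_ne_one hz
  rw [heq]
  exact hcl.isOpen

theorem isPContinuumSuccSpace_of_isSelfInjective [T1Space X] (hX : IsZeroDimensional X)
    (hR : IsSelfInjective (LocallyConstant X ℝ ⧸ finiteSupportIdeal X)) :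
    IsPContinuumSuccSpace ↥(isolatedPoints X)ᶜ := by
  classical
  intro S hS hcard
  refine ⟨isClosed_sInter fun s hs => (hS s hs).isClosed, ?_⟩
  obtain ⟨c⟩ : Nonempty (S ↪ ℝ) := by
    rw [← Cardinal.lift_mk_le']
    simpa [Cardinal.mk_real] using hcard
  -- Disjointify the complements along a well-order, removing closures to keep the pieces open.
  let V : S → Set ↥(isolatedPoints X)ᶜ := fun s =>
    (s : Set _)ᶜ \ closure (⋃ t : {t : S // WellOrderingRel t s}, ((t : S) : Set _)ᶜ)
  have hVo : ∀ s, IsOpen (V s) := fun s =>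
    (hS s s.2).compl.isOpen.sdiff isClosed_closure
  have hlt : ∀ s t x, WellOrderingRel s t → x ∈ V s → x ∉ V t := fun s t x hst hs ht =>
    ht.2 (subset_closure (Set.mem_iUnion.2 ⟨⟨s, hst⟩, hs.1⟩))
  have huniq : ∀ s t x, x ∈ V s → x ∈ V t → s = t := by
    intro s t x hs ht
    rcases trichotomous_of WellOrderingRel s t with h | h | h
    · exact (hlt s t x h hs ht).elim
    · exact h
    · exact (hlt t s x h ht hs).elim
  set W : Set ↥(isolatedPoints X)ᶜ := (⋂₀ S)ᶜ with hW
  have hVW : ∀ s, V s ⊆ W := fun s x hx h => hx.1 (h s s.2)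
  -- The exponential keeps the labels of the pieces distinct from the outside value `0`.
  let f : ↥(isolatedPoints X)ᶜ → ℝ := fun y =>
    if h : ∃ s, y ∈ V s then Real.exp (c h.choose) else 0
  have hfV : ∀ s, ∀ y ∈ V s, f y = Real.exp (c s) := by
    intro s y hy
    have h : ∃ s, y ∈ V s := ⟨s, hy⟩
    simp only [f, dif_pos h, huniq _ _ _ h.choose_spec hy]
  have hf0 : ∀ y ∉ closure W, f y = 0 := by
    intro y hy
    exact dif_neg fun ⟨s, hs⟩ => hy (subset_closure (hVW s hs))
  have hD : Dense ((⋃ s, V s) ∪ (closure W)ᶜ) := by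
    rw [dense_iff_inter_open]
    rintro O hO ⟨x, hx⟩
    by_cases hxW : x ∈ closure W
    · obtain ⟨z, hzO, hzW⟩ := mem_closure_iff.1 hxW O hO hx
      have hne : {s : S | (O ∩ (s : Set _)ᶜ).Nonempty}.Nonempty := by
        obtain ⟨s, hs, hzs⟩ : ∃ s ∈ S, z ∉ s := by simpa [hW] using hzW
        exact ⟨⟨s, hs⟩, z, hzO, hzs⟩
      have wf : WellFounded (WellOrderingRel : S → S → Prop) := IsWellFounded.wf
      obtain ⟨s, ⟨w, hwO, hws⟩, hmin⟩ := wf.has_min _ hne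
      refine ⟨w, hwO, Or.inl (Set.mem_iUnion.2 ⟨s, hws, fun hcl => ?_⟩)⟩
      obtain ⟨v, hvO, hv⟩ := mem_closure_iff.1 hcl O hO hwO
      obtain ⟨t, ht⟩ := Set.mem_iUnion.1 hv
      exact hmin t ⟨v, hvO, ht⟩ t.2
    · exact ⟨x, hx, Or.inr hxW⟩
  obtain ⟨F, hF⟩ := exists_locallyConstant_extension hX hR hD f (by
    rintro y (hy | hy)
    · obtain ⟨s, hs⟩ := Set.mem_iUnion.1 hy
      filter_upwards [(hVo s).mem_nhds hs] with z hz
      rw [hfV s z hz, hfV s y hs]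
    · filter_upwards [isClosed_closure.isOpen_compl.mem_nhds hy] with z hz
      rw [hf0 z hz, hf0 y hy])
  have hWo : IsOpen W := by
    rw [hW, Set.compl_sInter]
    refine isOpen_sUnion ?_
    rintro _ ⟨s, hs, rfl⟩
    exact (hS s hs).compl.isOpen
  rw [← isClosed_compl_iff, ← closure_subset_iff_isClosed]
  intro x hx
  have hNo : IsOpen {z : ↥(isolatedPoints X)ᶜ | F (z : X) = F (x : X)} :=
    (F.isLocallyConstant.isClopen_fiber _).isOpen.preimage continuous_subtype_val
  obtain ⟨z, ⟨hzN, hzW⟩, hzD⟩ :=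
    hD.inter_open_nonempty _ (hNo.inter hWo) (mem_closure_iff.1 hx _ hNo rfl)
  obtain ⟨s, hs⟩ : ∃ s, z ∈ V s := by
    rcases hzD with h | h
    · exact Set.mem_iUnion.1 h
    · exact (h (subset_closure hzW)).elim
  have hxs : F (x : X) = Real.exp (c s) := by
    rw [← hfV s z hs, ← hF z hzD]
    exact hzN.symm
  -- Near `x`, the constancy of `F` leaves only one piece `V s` of the dense set, so `x` lies in the
  -- closed set `sᶜ`.
  have hxcl : x ∈ closure ((s : Set ↥(isolatedPoints X)ᶜ)ᶜ) := by
    refine closure_mono ?_ (hD.open_subset_closure_inter hNo rfl)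
    rintro w ⟨hwN, hwD⟩
    have hw : f w = Real.exp (c s) := by
      rw [← hF w hwD, ← hxs]
      exact hwN
    rcases hwD with h | h
    · obtain ⟨t, ht⟩ := Set.mem_iUnion.1 h
      rw [hfV t w ht] at hw
      rw [← c.injective (Real.exp_injective hw)]
      exact ht.1
    · rw [hf0 w h] at hw
      exact ((Real.exp_pos _).ne hw).elim
  rw [(hS s s.2).compl.isClosed.closure_eq] at hxcl
  exact fun h => hxcl (h s s.2)

end Forward

/-! ### Sufficiency of the three conditions. -/

section Backward

/-- In an extremally disconnected `P_{𝔠⁺}`-space, disjoint open sets indexed by the reals are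
separated by a locally constant function. -/
theorem exists_locallyConstant_eq_on {Y : Type*} [TopologicalSpace Y]
    [ExtremallyDisconnected Y] (hP : IsPContinuumSuccSpace Y) {V : ℝ → Set Y}
    (hV : ∀ r, IsOpen (V r)) (hd : ∀ r s, r ≠ s → Disjoint (V r) (V s)) :
    ∃ G : LocallyConstant Y ℝ, ∀ r, ∀ y ∈ V r, G y = r := by
  classical
  have hW : ∀ r, IsClopen (closure (V r)) := fun r =>
    ⟨isClosed_closure, ExtremallyDisconnected.open_closure _ (hV r)⟩
  have hdW : ∀ r s y, y ∈ closure (V r) → y ∈ closure (V s) → r = s := by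
    intro r s y hr hs
    by_contra hne
    exact Set.disjoint_left.1
      (((hd r s hne).closure_left (hV s)).closure_right (hW r).isOpen) hr hs
  -- The points outside all the closures form an intersection of continuum many clopen sets at most,
  -- so the default value `0` there is locally constant.
  have hU : IsClopen (⋂₀ Set.range fun r => (closure (V r))ᶜ) := by
    refine hP _ ?_ ?_
    · rintro _ ⟨r, rfl⟩
      exact (hW r).compl
    · have := Cardinal.mk_range_le_lift (f := fun r => (closure (V r))ᶜ)
      simpa [Cardinal.mk_real] using this
  let G : Y → ℝ := fun y => if h : ∃ r, y ∈ closure (V r) then h.choose else 0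
  have hG : ∀ r, ∀ y ∈ closure (V r), G y = r := by
    intro r y hy
    have h : ∃ r, y ∈ closure (V r) := ⟨r, hy⟩
    simp only [G, dif_pos h]
    exact hdW _ _ _ h.choose_spec hy
  refine ⟨⟨G, ?_⟩, fun r y hy => hG r y (subset_closure hy)⟩
  rw [IsLocallyConstant.iff_eventually_eq]
  intro y
  by_cases h : ∃ r, y ∈ closure (V r)
  · obtain ⟨r, hr⟩ := h
    filter_upwards [(hW r).isOpen.mem_nhds hr] with z hz
    rw [hG r z hz, hG r y hr]
  · have hy : y ∈ ⋂₀ Set.range fun r => (closure (V r))ᶜ := by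
      rintro _ ⟨r, rfl⟩
      exact fun hr => h ⟨r, hr⟩
    filter_upwards [hU.isOpen.mem_nhds hy] with z hz
    have hz' : ¬ ∃ r, z ∈ closure (V r) := fun ⟨r, hr⟩ => hz _ ⟨r, rfl⟩ hr
    simp only [G, dif_neg h, dif_neg hz']

variable {X : Type*} [TopologicalSpace X]

theorem isSelfInjective_of_conditions [T1Space X]
    (h1 : ∀ S : Set X, S ⊆ isolatedPoints X → S.Infinite → ∃ x, AccPt x (Filter.principal S))
    [ExtremallyDisconnected ↥(isolatedPoints X)ᶜ]
    (h2 : IsPContinuumSuccSpace ↥(isolatedPoints X)ᶜ)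
    (h3 : IsCdEmbedded (isolatedPoints X)ᶜ) :
    IsSelfInjective (LocallyConstant X ℝ ⧸ finiteSupportIdeal X) := by
  classical
  intro I φ
  let π := Ideal.Quotient.mk (finiteSupportIdeal X)
  -- `Q h k` says that `φ` maps the class of `h` to the class of `k`
  let Q : LocallyConstant X ℝ → LocallyConstant X ℝ → Prop := fun h k =>
    ∃ hh : π h ∈ I, φ ⟨π h, hh⟩ = π k
  have hev : ∀ {h k : LocallyConstant X ℝ}, π h = π k → ∀ y ∈ (isolatedPoints X)ᶜ, h y = k y := by
    intro h k hk y hy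
    have := apply_eq_zero_of_mem_finiteSupportIdeal (Ideal.Quotient.eq.1 hk) hy
    rwa [LocallyConstant.sub_apply, sub_eq_zero] at this
  have hcross : ∀ {h k h' k'}, Q h k → Q h' k' → ∀ y ∈ (isolatedPoints X)ᶜ,
      h y * k' y = h' y * k y := by
    rintro h k h' k' ⟨hh, hk⟩ ⟨hh', hk'⟩ y hy
    have : π (h * k') = π (h' * k) := by
      rw [map_mul, map_mul, ← hk, ← hk', ← smul_eq_mul, ← smul_eq_mul, ← map_smul, ← map_smul]
      congr 1
      ext
      simp [mul_comm]
    simpa using hev this y hy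
  have hvanish : ∀ {h k}, Q h k → ∀ y ∈ (isolatedPoints X)ᶜ, h y = 0 → k y = 0 := by
    rintro h k ⟨hh, hk⟩ y hy h0
    -- As `u * h = h`, linearity gives `k = u * k` modulo `C_F(X)`, so `k` vanishes with `h` on `Y`.
    let u := LocallyConstant.charFn ℝ h.isClopen_support
    have huh : u * h = h := by
      ext x
      by_cases hx : h x = 0 <;> simp [u, LocallyConstant.coe_charFn, hx]
    have : π k = π (u * k) := by
      rw [map_mul, ← hk, ← smul_eq_mul, ← map_smul]
      congr 1
      ext
      simp [← map_mul, huh]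
    rw [hev this y hy]
    simp [u, LocallyConstant.coe_charFn, h0]
  -- `V r` is where the ratio `k / h` equals `r`; `hcross` makes it independent of the pair.
  let V : ℝ → Set ↥(isolatedPoints X)ᶜ := fun r =>
    {y | ∃ h k, Q h k ∧ h (y : X) ≠ 0 ∧ k (y : X) = r * h (y : X)}
  have hVo : ∀ r, IsOpen (V r) := by
    intro r
    rw [isOpen_iff_eventually]
    rintro y ⟨h, k, hQ, hne, hr⟩
    have e1 : ∀ᶠ z : ↥(isolatedPoints X)ᶜ in nhds y, h (z : X) = h (y : X) := continuous_subtype_val.continuousAt.eventually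
      (h.isLocallyConstant.eventually_eq (y : X))
    have e2 : ∀ᶠ z : ↥(isolatedPoints X)ᶜ in nhds y, k (z : X) = k (y : X) := continuous_subtype_val.continuousAt.eventually
      (k.isLocallyConstant.eventually_eq (y : X))
    filter_upwards [e1, e2] with z hz1 hz2
    exact ⟨h, k, hQ, by rwa [hz1], by rw [hz1, hz2, hr]⟩
  have hVd : ∀ r s, r ≠ s → Disjoint (V r) (V s) := by
    intro r s hrs
    rw [Set.disjoint_left]
    rintro y ⟨h, k, hQ, hne, hr⟩ ⟨h', k', hQ', hne', hs⟩
    have := hcross hQ hQ' y y.2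
    rw [hr, hs] at this
    refine hrs (mul_right_cancel₀ (mul_ne_zero hne hne') ?_)
    linear_combination -this
  obtain ⟨G, hG⟩ := exists_locallyConstant_eq_on h2 hVo hVd
  obtain ⟨F, hF⟩ := h3 G
  refine ⟨LinearMap.mulLeft _ (π F), fun z hz => ?_⟩
  obtain ⟨h, rfl⟩ := Ideal.Quotient.mk_surjective z
  obtain ⟨k, hk⟩ := Ideal.Quotient.mk_surjective (φ ⟨_, hz⟩)
  have hQ : Q h k := ⟨hz, hk.symm⟩
  rw [← hk, LinearMap.mulLeft_apply, ← map_mul, Ideal.Quotient.eq]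
  refine mem_finiteSupportIdeal_of_eqOn h1 fun y hy => ?_
  rw [LocallyConstant.sub_apply, LocallyConstant.mul_apply, sub_eq_zero]
  by_cases h0 : h y = 0
  · rw [h0, mul_zero, hvanish hQ y hy h0]
  · have hyV : (⟨y, hy⟩ : ↥(isolatedPoints X)ᶜ) ∈ V (k y / h y) :=
      ⟨h, k, hQ, h0, (div_mul_cancel₀ _ h0).symm⟩
    rw [hF ⟨y, hy⟩, hG _ _ hyV, div_mul_cancel₀ _ h0]

end Backward

theorem theorem4p7 {X : Type*} [TopologicalSpace X] [T2Space X] (hX : IsZeroDimensional X) :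
    IsSelfInjective (LocallyConstant X ℝ ⧸ finiteSupportIdeal X) ↔
      (∀ S : Set X, S ⊆ isolatedPoints X → S.Infinite →
        ∃ x : X, AccPt x (Filter.principal S)) ∧
      (ExtremallyDisconnected ↥(isolatedPoints X)ᶜ ∧
        IsPContinuumSuccSpace ↥(isolatedPoints X)ᶜ) ∧
      IsCdEmbedded (isolatedPoints X)ᶜ := by
  constructor
  · intro hR
    exact ⟨fun S hS hinf => exists_accPt_of_isSelfInjective hR hS hinf,
      ⟨extremallyDisconnected_of_isSelfInjective hX hR,
        isPContinuumSuccSpace_of_isSelfInjective hX hR⟩,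
      isCdEmbedded_of_isSelfInjective hX hR⟩
  · rintro ⟨h1, ⟨h2, h2'⟩, h3⟩
    exact isSelfInjective_of_conditions h1 h2' h3
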